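/- **Birkhoff–Grothendieck theorem on the tropical projective line.** Let $\mathbb T=\mathbb R\cup\{-\infty\}$ with tropical operations $\max$ and $+$ (and its order topology), and let $\mathbb{TP}^1=(\mathbb T^2\setminus\{(-\infty,-\infty)\})/\mathbb R$, where $\mathbb R$ acts by simultaneous translation, with the quotient topology and the open cover $U_i=\{x_i\neq-\infty\}$, $i=0,1$. A *regular invertible function* on an open $W\subseteq\mathbb{TP}^1$ is a continuous function $W\to\mathbb R$ that locally, at the points of $W$ with both coordinates finite, is of the form $m(x_1-x_0)+c$ with $m\in\mathbb Z$, $c\in\mathbb R$. On $W\times\mathbb R^n$ the regular invertible functions are those that are locally the sum of a regular invertible function on $W$ and an integer linear form on $\mathbb R^n$. Let $G(n)$ be the group of tropical $n\times n$ matrices with exactly one finite entry in each row and each column, acting on $\mathbb R^n$ by $a\mapsto A\odot a$. A *tropical vector bundle of rank $n\ge 0$* on $\mathbb{TP}^1$ is a topological space $E$ with a sheaf of groups of continuous real functions containing the constants (its regular invertible functions), together with a projection $\pi:E\to\mathbb{TP}^1$ (continuous, and pulling regular invertible functions back to such), a finite open cover $(V_i)$ of $\mathbb{TP}^1$ and homeomorphisms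 $\Phi_i:\pi^{-1}(V_i)\to V_i\times\mathbb R^n$ over $V_i$ that identify the regular invertible functions on both sides, such that each $\Phi_j\circ\Phi_i^{-1}$ has the form $(x,a)\mapsto(x,M_{ij}(x)\odot a)$ with $M_{ij}:V_i\cap V_j\to G(n)$ whose entries are either regular invertible on $V_i\cap V_j$ or constantly $-\infty$. A *morphism* $E\to F$ of bundles of ranks $e$ and $f$ is a continuous map over $\mathbb{TP}^1$ that pulls regular invertible functions back to regular invertible functions and that, over the members $V$ of some finite open cover and in restrictions to $V$ of the given local trivializations, has the form $(x,a)\mapsto(x,A(x)\odot a)$ (entries $-\infty$ of $A(x)\odot a$ being replaced by $0$), where $A(x)$ is an $f\times e$ tropical matrix with at most one finite entry in each row and the entries of $A$ are regular invertible on $V$ or constantly $-\infty$. An isomorphism is a morphism with an inverse morphism. For $d\in\mathbb Z$ let $\mathcal O(d)$ be the line bundle glued from $U_0\times\mathbb R$ and $U_1\times\mathbb R$ with transition maps $M_{ij}(x)=d\,(x_j-x_i)$, and let $\mathcal O(d_1)\oplus\cdots\oplus\mathcal O(d_n)$ be the bundle glued from $U_0\times\mathbb R^n$ and $U_1\times\mathbb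 R^n$ with the diagonal transition maps with entries $d_1(x_j-x_i),\dots,d_n(x_j-x_i)$ on the diagonal and $-\infty$ elsewhere. **Proposition.** For every tropical vector bundle $E$ of rank $n$ on $\mathbb{TP}^1$ there are integers $d_1,\dots,d_n$ such that $$E\cong\bigoplus_{i=1}^n\mathcal O(d_i).$$ -/

import Mathlib

namespace TropVB

open Set Filter Topology TopologicalSpace Bundle

noncomputable section

universe u v w

/-! ### Tropical numbers and tropical matrices -/

/-- The tropical numbers `𝕋 = ℝ ∪ {-∞}`; tropical addition is `⊔`, tropical multiplication
is `+`, and `-∞` is `⊥`. -/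
abbrev TNum : Type := WithBot ℝ

/-- `𝕋 = [-∞, ∞)` carries its order topology. -/
instance : TopologicalSpace TNum := Preorder.topology TNum

instance : OrderTopology TNum := ⟨rfl⟩

/-- Tropical `m × n` matrices. -/
abbrev TMat (m n : ℕ) : Type := Matrix (Fin m) (Fin n) TNum

/-- Tropical matrix product. -/
def tmul {m n p : ℕ} (A : TMat m n) (B : TMat n p) : TMat m p :=
  fun i j => Finset.univ.sup fun k => A i k + B k j

/-- The tropical diagonal matrix `D(a₁, …, aₙ)`. -/
def tdiag {n : ℕ} (a : Fin n → TNum) : TMat n n :=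
  fun i j => if i = j then a i else ⊥

/-- The tropical identity matrix `Eₙ = D(0, …, 0)`. -/
def tone (n : ℕ) : TMat n n := tdiag fun _ => 0

/-- `G(r × s)`: at most one finite entry in each row. -/
def InG {r s : ℕ} (A : TMat r s) : Prop :=
  ∀ i, ∀ j k, A i j ≠ ⊥ → A i k ≠ ⊥ → j = k

/-- `G(r)`: exactly one finite entry in each row and in each column. -/
def InGL {r : ℕ} (A : TMat r r) : Prop :=
  (∀ i, ∃! j, A i j ≠ ⊥) ∧ ∀ j, ∃! i, A i j ≠ ⊥

/-- The map `f_A : ℝˢ → ℝʳ`, `a ↦ A ⊙ a`, with entries `-∞` of the result replaced by `0`. -/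
def act {r s : ℕ} (A : TMat r s) (a : Fin s → ℝ) : Fin r → ℝ :=
  fun i => (Finset.univ.sup fun k => A i k + ((a k : ℝ) : TNum)).unbotD 0

/-! ### Tropical spaces -/

/-- A topological space with a sheaf of groups of continuous real functions containing the
constants, the sheaf `𝒪*` of regular invertible functions. It is given by its germs:
`RegAt f x` says that the germ at `x` of `f` is a germ of a regular invertible function. -/
class TropicalSpace (X : Type u) [TopologicalSpace X] where
  RegAt : (X → ℝ) → X → Prop
  congr : ∀ {f g : X → ℝ} {x : X}, f =ᶠ[𝓝 x] g → RegAt f x → RegAt g x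
  eventually : ∀ {f : X → ℝ} {x : X}, RegAt f x → ∀ᶠ y in 𝓝 x, RegAt f y
  continuousAt : ∀ {f : X → ℝ} {x : X}, RegAt f x → ContinuousAt f x
  const : ∀ (c : ℝ) (x : X), RegAt (fun _ => c) x
  add : ∀ {f g : X → ℝ} {x : X}, RegAt f x → RegAt g x → RegAt (fun y => f y + g y) x
  neg : ∀ {f : X → ℝ} {x : X}, RegAt f x → RegAt (fun y => -f y) x

open TropicalSpace

/-- `f` restricts to a regular invertible function on the open set `W`. -/
def RegularOn {X : Type u} [TopologicalSpace X] [TropicalSpace X] (W : Set X) (f : X → ℝ) :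
    Prop :=
  ∀ x ∈ W, RegAt f x

/-- Morphisms of tropical spaces: continuous maps that pull regular invertible functions back
to regular invertible functions. -/
def IsTropicalMap {X : Type u} {Y : Type v} [TopologicalSpace X] [TropicalSpace X]
    [TopologicalSpace Y] [TropicalSpace Y] (g : X → Y) : Prop :=
  Continuous g ∧ ∀ (f : Y → ℝ) (x : X), RegAt f (g x) → RegAt (f ∘ g) x

section algebra

variable {X : Type u} [TopologicalSpace X] [TropicalSpace X]

lemma regAt_nsmul {f : X → ℝ} {x : X} (hf : RegAt f x) (m : ℕ) :
    RegAt (fun y => (m : ℝ) * f y) x := by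
  induction m with
  | zero => simpa using const (0 : ℝ) x
  | succ k ih =>
    have := add ih hf
    refine congr (Eventually.of_forall fun y => ?_) this
    push_cast; ring

lemma regAt_zsmul {f : X → ℝ} {x : X} (hf : RegAt f x) (m : ℤ) :
    RegAt (fun y => (m : ℝ) * f y) x := by
  obtain ⟨k, rfl | rfl⟩ := m.eq_nat_or_neg
  · simpa using regAt_nsmul hf k
  · simpa using neg (regAt_nsmul hf k)

lemma regAt_sum {κ : Type*} (s : Finset κ) {f : κ → X → ℝ} {x : X}
    (hf : ∀ k ∈ s, RegAt (f k) x) : RegAt (fun y => ∑ k ∈ s, f k y) x := by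
  classical
  induction s using Finset.induction_on with
  | empty => simpa using const (0 : ℝ) x
  | insert a s ha ih =>
    simp only [Finset.sum_insert ha]
    exact add (hf a (Finset.mem_insert_self _ _))
      (ih fun k hk => hf k (Finset.mem_insert_of_mem hk))

/-- The product of a tropical space with `ℝʳ`: the regular invertible functions are locally the
sums of one on `X` and an integer linear form on `ℝʳ`. -/
instance prodReal (r : ℕ) : TropicalSpace (X × (Fin r → ℝ)) where
  RegAt f p := ∃ (φ : X → ℝ) (m : Fin r → ℤ), RegAt φ p.1 ∧
    ∀ᶠ q in 𝓝 p, f q = φ q.1 + ∑ k, (m k : ℝ) * q.2 k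
  congr := by
    rintro f g p h ⟨φ, m, hφ, hf⟩
    exact ⟨φ, m, hφ, by filter_upwards [h, hf] with q h1 h2; rw [← h1, h2]⟩
  eventually := by
    rintro f p ⟨φ, m, hφ, hf⟩
    filter_upwards [hf.eventually_nhds, continuousAt_fst.eventually (eventually hφ)] with q h1 h2
    exact ⟨φ, m, h2, h1⟩
  continuousAt := by
    rintro f p ⟨φ, m, hφ, hf⟩
    refine ContinuousAt.congr ?_ (EventuallyEq.symm hf)
    have h1 : ContinuousAt (fun q : X × (Fin r → ℝ) => φ q.1) p :=
      ContinuousAt.comp (f := Prod.fst) (continuousAt hφ) continuousAt_fst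
    exact h1.add (by fun_prop)
  const c p := ⟨fun _ => c, 0, const c _, by simp⟩
  add := by
    rintro f g p ⟨φ, m, hφ, hf⟩ ⟨ψ, l, hψ, hg⟩
    refine ⟨_, m + l, add hφ hψ, ?_⟩
    filter_upwards [hf, hg] with q h1 h2
    simp only [h1, h2, Pi.add_apply, Int.cast_add, add_mul, Finset.sum_add_distrib]
    ring
  neg := by
    rintro f p ⟨φ, m, hφ, hf⟩
    refine ⟨_, -m, neg hφ, ?_⟩
    filter_upwards [hf] with q h1
    simp only [h1, Pi.neg_apply, Int.cast_neg, neg_mul, Finset.sum_neg_distrib]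
    ring

lemma regAt_fst {r : ℕ} {φ : X → ℝ} {p : X × (Fin r → ℝ)} (hφ : RegAt φ p.1) :
    RegAt (fun q : X × (Fin r → ℝ) => φ q.1) p :=
  ⟨φ, 0, hφ, by simp⟩

lemma regAt_coord {r : ℕ} (k : Fin r) (p : X × (Fin r → ℝ)) :
    RegAt (fun q : X × (Fin r → ℝ) => q.2 k) p := by
  refine ⟨fun _ => 0, fun l => if l = k then 1 else 0, const 0 _, Eventually.of_forall fun q => ?_⟩
  simp

end algebra

/-! ### Tropical vector bundles -/

section bundles

variable {X : Type u} [TopologicalSpace X] [TropicalSpace X]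

/-- On `W`, the tropical-valued function `g` is regular invertible or constantly `-∞`. -/
def RegularOrBot (W : Set X) (g : X → TNum) : Prop :=
  (∃ φ : X → ℝ, RegularOn W φ ∧ ∀ x ∈ W, g x = ((φ x : ℝ) : TNum)) ∨ ∀ x ∈ W, g x = ⊥

/-- `M` is a map `W → G(r)` with entries that are regular invertible or constantly `-∞`. -/
def IsTransition {r : ℕ} (W : Set X) (M : X → TMat r r) : Prop :=
  (∀ x ∈ W, InGL (M x)) ∧ ∀ k l, RegularOrBot W fun x => M x k l

variable (X) in
/-- A tropical vector bundle of rank `r` over `X`. A `Trivialization (Fin r → ℝ) proj` is a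
homeomorphism from `proj ⁻¹' U` onto `U × ℝʳ`, for an open set `U` (its `baseSet`), that commutes
with the projections to `U`. -/
structure TropicalVectorBundle (r : ℕ) where
  /-- the total space -/
  Total : Type v
  [topTotal : TopologicalSpace Total]
  [tropTotal : TropicalSpace Total]
  /-- the bundle projection -/
  proj : Total → X
  isTropicalMap_proj : IsTropicalMap proj
  /-- the number of local trivializations -/
  s : ℕ
  /-- the local trivializations -/
  triv : Fin s → Trivialization (Fin r → ℝ) proj
  cover : ∀ x, ∃ i, x ∈ (triv i).baseSet
  /-- the trivializations are isomorphisms of tropical spaces; in particular the coordinates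
  `p ↦ (triv i p).2 j` are regular invertible functions -/
  regAt_triv : ∀ i, ∀ p ∈ (triv i).source, ∀ f : X × (Fin r → ℝ) → ℝ,
    RegAt (f ∘ triv i) p ↔ RegAt f (triv i p)
  /-- the transition maps -/
  transition : ∀ i j, ∃ M : X → TMat r r,
    IsTransition ((triv i).baseSet ∩ (triv j).baseSet) M ∧
    ∀ x ∈ (triv i).baseSet ∩ (triv j).baseSet, ∀ a : Fin r → ℝ,
      triv j ((triv i).toOpenPartialHomeomorph.symm (x, a)) = (x, act (M x) a)

attribute [instance] TropicalVectorBundle.topTotal TropicalVectorBundle.tropTotal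

/-- Morphisms of tropical vector bundles over `X`: morphisms of tropical spaces over `X` that,
with respect to the restrictions of the local trivializations to the members of some finite open
cover `V`, are given by maps `A k : V k → G(f × e)` with entries that are regular invertible or
constantly `-∞`. -/
def IsBundleMorphism {e f : ℕ} (E : TropicalVectorBundle.{u, v} X e)
    (F : TropicalVectorBundle.{u, w} X f) (Ψ : E.Total → F.Total) : Prop :=
  IsTropicalMap Ψ ∧ (∀ p, F.proj (Ψ p) = E.proj p) ∧
  ∃ (t : ℕ) (V : Fin t → Opens X) (i : Fin t → Fin E.s) (j : Fin t → Fin F.s)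
    (A : Fin t → X → TMat f e),
    (∀ x, ∃ k, x ∈ V k) ∧
    ∀ k, (V k : Set X) ⊆ (E.triv (i k)).baseSet ∩ (F.triv (j k)).baseSet ∧
      (∀ x ∈ V k, InG (A k x)) ∧
      (∀ c d, RegularOrBot (V k) fun x => A k x c d) ∧
      ∀ x ∈ V k, ∀ a : Fin e → ℝ,
        F.triv (j k) (Ψ ((E.triv (i k)).toOpenPartialHomeomorph.symm (x, a))) =
          (x, act (A k x) a)

/-- `E ≅ F`: there are mutually inverse morphisms of tropical vector bundles. -/
def Isomorphic {e f : ℕ} (E : TropicalVectorBundle.{u, v} X e)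
    (F : TropicalVectorBundle.{u, w} X f) : Prop :=
  ∃ (Ψ : E.Total → F.Total) (Θ : F.Total → E.Total),
    IsBundleMorphism E F Ψ ∧ IsBundleMorphism F E Θ ∧
    Function.LeftInverse Θ Ψ ∧ Function.RightInverse Θ Ψ

/-! ### Bundles from transition maps -/

/-- Transition maps for a bundle of rank `r` that is trivialized over the members of the open
cover `U`; `M i j` describes `Φ_j ∘ Φ_i⁻¹`. -/
structure TransitionData {s : ℕ} (U : Fin s → Opens X) (r : ℕ) where
  cover : ∀ x, ∃ i, x ∈ U i
  M : Fin s → Fin s → X → TMat r r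
  isTransition : ∀ i j, IsTransition ((U i : Set X) ∩ U j) (M i j)
  self : ∀ i, ∀ x ∈ U i, M i i x = tone r
  comp : ∀ i j k, ∀ x ∈ (U i : Set X) ∩ U j ∩ U k, tmul (M j k x) (M i j x) = M i k x

lemma IsTransition.normalForm {r : ℕ} {W : Set X} {M : X → TMat r r} (h : IsTransition W M)
    {p : X} (hp : p ∈ W) : ∃ (σ : Fin r → Fin r) (g : Fin r → X → ℝ),
      (∀ k, RegularOn W (g k)) ∧
      ∀ x ∈ W, ∀ k l, M x k l = if l = σ k then ((g k x : ℝ) : TNum) else ⊥ := by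
  choose σ hσ hσu using (h.1 p hp).1
  have hg : ∀ k, ∃ φ : X → ℝ, RegularOn W φ ∧ ∀ x ∈ W, M x k (σ k) = ((φ x : ℝ) : TNum) := by
    intro k
    rcases h.2 k (σ k) with h' | h'
    · exact h'
    · exact absurd (h' p hp) (hσ k)
  choose g hg1 hg2 using hg
  refine ⟨σ, g, hg1, fun x hx k l => ?_⟩
  split_ifs with hl
  · rw [hl, hg2 k x hx]
  · by_contra hne
    obtain ⟨j, -, hj⟩ := (h.1 x hx).1 k
    refine hl ((hj l hne).trans (hj (σ k) ?_).symm)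
    simp only [hg2 k x hx]
    exact WithBot.coe_ne_bot

lemma act_of_normalForm {r : ℕ} {A : TMat r r} {σ : Fin r → Fin r} {g : Fin r → ℝ}
    (h : ∀ k l, A k l = if l = σ k then ((g k : ℝ) : TNum) else ⊥) (a : Fin r → ℝ) (k : Fin r) :
    act A a k = g k + a (σ k) := by
  have : (Finset.univ.sup fun l => A k l + ((a l : ℝ) : TNum)) =
      ((g k + a (σ k) : ℝ) : TNum) := by
    apply le_antisymm
    · refine Finset.sup_le fun l _ => ?_
      rw [h k l]
      split_ifs with hl
      · rw [hl]; exact le_of_eq (by norm_cast)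
      · simp
    · refine le_trans (le_of_eq ?_)
        (Finset.le_sup (f := fun l => A k l + ((a l : ℝ) : TNum)) (Finset.mem_univ (σ k)))
      simp only [h, if_true]
      norm_cast
  rw [act, this, WithBot.unbotD_coe]

lemma tmul_of_normalForm {r : ℕ} {A B : TMat r r} {σ : Fin r → Fin r} {g : Fin r → ℝ}
    (h : ∀ k l, A k l = if l = σ k then ((g k : ℝ) : TNum) else ⊥) (k m : Fin r) :
    tmul A B k m = ((g k : ℝ) : TNum) + B (σ k) m := by
  apply le_antisymm
  · refine Finset.sup_le fun l _ => ?_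
    rw [h k l]
    split_ifs with hl
    · rw [hl]
    · simp
  · refine le_trans (le_of_eq ?_)
      (Finset.le_sup (f := fun l => A k l + B l m) (Finset.mem_univ (σ k)))
    simp only [h, if_true]

namespace TransitionData

variable {s r : ℕ} {U : Fin s → Opens X} (T : TransitionData U r)

/-- The gluing data of Mathlib that correspond to the transition maps. -/
def core : FiberBundleCore (Fin s) X (Fin r → ℝ) where
  baseSet i := U i
  isOpen_baseSet i := (U i).isOpen
  indexAt x := (T.cover x).choose
  mem_baseSet_at x := (T.cover x).choose_spec
  coordChange i j x a := act (T.M i j x) a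
  coordChange_self i x hx a := by
    rw [T.self i x hx]
    funext k
    rw [act_of_normalForm (σ := id) (g := fun _ => 0)]
    · simp
    · intro k l
      simp [tone, tdiag, eq_comm]
  continuousOn_coordChange i j := by
    rintro ⟨p, a⟩ ⟨hp, -⟩
    obtain ⟨σ, g, hg, hM⟩ := (T.isTransition i j).normalForm hp
    apply ContinuousWithinAt.congr_of_mem
      (f := fun q : X × (Fin r → ℝ) => fun k => g k q.1 + q.2 (σ k))
    · refine ContinuousAt.continuousWithinAt (continuousAt_pi.2 fun k => ?_)
      have h1 : ContinuousAt (fun q : X × (Fin r → ℝ) => g k q.1) (p, a) :=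
        ContinuousAt.comp (f := Prod.fst) (continuousAt (hg k p hp)) continuousAt_fst
      exact h1.add (by fun_prop)
    · rintro ⟨q, b⟩ ⟨hq, -⟩
      funext k
      exact act_of_normalForm (hM q hq) b k
    · exact ⟨hp, trivial⟩
  coordChange_comp i j k x hx a := by
    obtain ⟨σ, g, -, hM⟩ := (T.isTransition i j).normalForm (p := x) hx.1
    obtain ⟨τ, h, -, hN⟩ := (T.isTransition j k).normalForm (p := x) ⟨hx.1.2, hx.2⟩
    rw [← T.comp i j k x hx]
    funext c
    rw [act_of_normalForm (hN x ⟨hx.1.2, hx.2⟩), act_of_normalForm (hM x hx.1),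
      act_of_normalForm (σ := fun c => σ (τ c)) (g := fun c => h c x + g (τ c) x), add_assoc]
    intro c l
    rw [tmul_of_normalForm (hN x ⟨hx.1.2, hx.2⟩), hM x hx.1]
    split_ifs <;> simp

/-- The local trivialization over `U i`. -/
def chart (i : Fin s) : Trivialization (Fin r → ℝ) T.core.proj := T.core.localTriv i

lemma mem_chart_source {i : Fin s} {p : T.core.TotalSpace} :
    p ∈ (T.chart i).source ↔ p.1 ∈ U i := Iff.rfl

lemma chart_fst (i : Fin s) (p : T.core.TotalSpace) : (T.chart i p).1 = p.1 := rfl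

lemma chart_symm {i : Fin s} {p : T.core.TotalSpace} (hp : p.1 ∈ U i) :
    (T.chart i).toOpenPartialHomeomorph.symm (T.chart i p) = p :=
  (T.chart i).toOpenPartialHomeomorph.left_inv (T.mem_chart_source.2 hp)

lemma chart_chart_symm (i j : Fin s) {x : X} (hx : x ∈ (U i : Set X) ∩ U j) (a : Fin r → ℝ) :
    T.chart j ((T.chart i).toOpenPartialHomeomorph.symm (x, a)) = (x, act (T.M i j x) a) :=
  Prod.ext rfl (T.core.coordChange_comp i (T.core.indexAt x) j x
    ⟨⟨hx.1, T.core.mem_baseSet_at x⟩, hx.2⟩ a)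

lemma chart_nhds {i : Fin s} {p : T.core.TotalSpace} (hp : p.1 ∈ U i) :
    map (T.chart i) (𝓝 p) = 𝓝 (T.chart i p) :=
  (T.chart i).toOpenPartialHomeomorph.map_nhds_eq (T.mem_chart_source.2 hp)

lemma regAt_transition (i j : Fin s) {x : X} (hx : x ∈ (U i : Set X) ∩ U j) (a : Fin r → ℝ)
    {f : X × (Fin r → ℝ) → ℝ} (hf : RegAt f (x, act (T.M i j x) a)) :
    RegAt (fun q : X × (Fin r → ℝ) => f (q.1, act (T.M i j q.1) q.2)) (x, a) := by
  obtain ⟨σ, g, hg, hM⟩ := (T.isTransition i j).normalForm hx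
  obtain ⟨φ, m, hφ, hfm⟩ := hf
  have hreg : RegAt (fun q : X × (Fin r → ℝ) =>
      φ q.1 + ∑ k, (m k : ℝ) * (g k q.1 + q.2 (σ k))) (x, a) := by
    refine add (regAt_fst hφ) (regAt_sum _ fun k _ => regAt_zsmul (add ?_ (regAt_coord _ _)) _)
    exact regAt_fst (hg k x hx)
  have hopen : ((U i : Set X) ∩ U j) ×ˢ univ ∈ 𝓝 (x, a) :=
    (((U i).isOpen.inter (U j).isOpen).prod isOpen_univ).mem_nhds ⟨hx, trivial⟩
  have hcont : ContinuousAt (fun q : X × (Fin r → ℝ) => (q.1, act (T.M i j q.1) q.2)) (x, a) :=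
    continuousAt_fst.prodMk ((T.core.continuousOn_coordChange i j).continuousAt hopen)
  refine congr ?_ hreg
  filter_upwards [hcont.eventually hfm, hopen] with q h1 h2
  rw [h1]
  simp only [act_of_normalForm (hM q.1 h2.1)]

lemma regAt_chart_of_regAt_chart (i j : Fin s) {p : T.core.TotalSpace} (hi : p.1 ∈ U i)
    (hj : p.1 ∈ U j) {f : T.core.TotalSpace → ℝ}
    (hf : RegAt (f ∘ (T.chart j).toOpenPartialHomeomorph.symm) (T.chart j p)) :
    RegAt (f ∘ (T.chart i).toOpenPartialHomeomorph.symm) (T.chart i p) := by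
  have hx : p.1 ∈ (U i : Set X) ∩ U j := ⟨hi, hj⟩
  have key := T.chart_chart_symm i j hx (T.chart i p).2
  have hpair : (p.1, (T.chart i p).2) = T.chart i p := rfl
  rw [hpair, T.chart_symm hi] at key
  rw [key] at hf
  have h := T.regAt_transition i j hx (T.chart i p).2 hf
  rw [hpair] at h
  refine congr ?_ h
  have hopen : ((U i : Set X) ∩ U j) ×ˢ univ ∈ 𝓝 (T.chart i p) :=
    (((U i).isOpen.inter (U j).isOpen).prod isOpen_univ).mem_nhds ⟨hx, trivial⟩
  filter_upwards [hopen] with q hq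
  have e : T.chart j ((T.chart i).toOpenPartialHomeomorph.symm q) =
      (q.1, act (T.M i j q.1) q.2) := T.chart_chart_symm i j hq.1 q.2
  have hq' : ((T.chart i).toOpenPartialHomeomorph.symm q).1 ∈ U j := hq.1.2
  simp only [Function.comp_apply]
  rw [← e, T.chart_symm hq']

/-- The total space glued from the pieces `U i × ℝʳ`. Its regular invertible functions are those
that are regular invertible in the local trivializations. -/
instance tropicalSpaceTotal : TropicalSpace T.core.TotalSpace where
  RegAt f p := ∃ i, p.1 ∈ U i ∧
    RegAt (f ∘ (T.chart i).toOpenPartialHomeomorph.symm) (T.chart i p)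
  congr := by
    rintro f g p h ⟨i, hi, hf⟩
    refine ⟨i, hi, congr ?_ hf⟩
    have hc : Tendsto (T.chart i).toOpenPartialHomeomorph.symm (𝓝 (T.chart i p)) (𝓝 p) :=
      (T.chart i).toOpenPartialHomeomorph.tendsto_symm (T.mem_chart_source.2 hi)
    exact hc.eventually h
  eventually := by
    rintro f p ⟨i, hi, hf⟩
    have h := eventually hf
    rw [← T.chart_nhds hi, eventually_map] at h
    filter_upwards [h, (T.chart i).open_source.mem_nhds (T.mem_chart_source.2 hi)] with q h1 h2
    exact ⟨i, T.mem_chart_source.1 h2, h1⟩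
  continuousAt := by
    rintro f p ⟨i, hi, hf⟩
    have h1 := continuousAt hf
    have h2 : ContinuousAt (T.chart i) p :=
      (T.chart i).toOpenPartialHomeomorph.continuousAt (T.mem_chart_source.2 hi)
    refine (ContinuousAt.comp h1 h2).congr ?_
    filter_upwards [(T.chart i).open_source.mem_nhds (T.mem_chart_source.2 hi)] with q hq
    simp only [Function.comp_apply]
    rw [T.chart_symm (T.mem_chart_source.1 hq)]
  const c p := by
    obtain ⟨i, hi⟩ := T.cover p.1
    exact ⟨i, hi, const c _⟩
  add := by
    rintro f g p ⟨i, hi, hf⟩ ⟨j, hj, hg⟩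
    exact ⟨i, hi, add hf (T.regAt_chart_of_regAt_chart i j hi hj hg)⟩
  neg := by
    rintro f p ⟨i, hi, hf⟩
    exact ⟨i, hi, neg hf⟩

lemma regAt_comp_chart (i : Fin s) {p : T.core.TotalSpace} (hp : p ∈ (T.chart i).source)
    (f : X × (Fin r → ℝ) → ℝ) : RegAt (f ∘ T.chart i) p ↔ RegAt f (T.chart i p) := by
  have hi := T.mem_chart_source.1 hp
  have hev : (f ∘ T.chart i) ∘ (T.chart i).toOpenPartialHomeomorph.symm
      =ᶠ[𝓝 (T.chart i p)] f := by
    have ht : (T.chart i).target ∈ 𝓝 (T.chart i p) :=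
      (T.chart i).open_target.mem_nhds ((T.chart i).toOpenPartialHomeomorph.map_source hp)
    filter_upwards [ht] with q hq
    exact congrArg f ((T.chart i).toOpenPartialHomeomorph.right_inv hq)
  constructor
  · rintro ⟨j, hj, h⟩
    exact congr hev (T.regAt_chart_of_regAt_chart i j hi hj h)
  · intro h
    exact ⟨i, hi, congr hev.symm h⟩

/-- The tropical vector bundle with the given transition maps. -/
def toBundle : TropicalVectorBundle.{u, u} X r where
  Total := T.core.TotalSpace
  proj := T.core.proj
  isTropicalMap_proj := by
    refine ⟨T.core.continuous_proj, fun f p hf => ?_⟩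
    obtain ⟨i, hi⟩ := T.cover p.1
    exact (T.regAt_comp_chart i (T.mem_chart_source.2 hi) fun q => f q.1).2 (regAt_fst hf)
  s := s
  triv := T.chart
  cover := T.cover
  regAt_triv i p hp f := T.regAt_comp_chart i hp f
  transition i j := ⟨T.M i j, T.isTransition i j, fun _ hx a => T.chart_chart_symm i j hx a⟩

end TransitionData

/-- The direct sum of line bundles that are trivialized over a common cover: its transition maps
are the direct sums (block diagonal matrices) of the given `1 × 1` transition maps. -/
def directSum {s n : ℕ} {U : Fin s → Opens X} (hU : ∀ x, ∃ i, x ∈ U i)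
    (L : Fin n → TransitionData U 1) :
    TransitionData U n where
  cover := hU
  M i j x := tdiag fun k => (L k).M i j x 0 0
  isTransition i j := by
    constructor
    · intro x hx
      have h : ∀ k, (L k).M i j x 0 0 ≠ ⊥ := by
        intro k
        obtain ⟨l, hl, -⟩ := (((L k).isTransition i j).1 x hx).1 0
        rwa [Subsingleton.elim l 0] at hl
      refine ⟨fun k => ⟨k, by simpa [tdiag] using h k, fun l hl => ?_⟩,
        fun k => ⟨k, by simpa [tdiag] using h k, fun l hl => ?_⟩⟩
      · by_contra hne
        exact hl (if_neg (Ne.symm hne))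
      · by_contra hne
        exact hl (if_neg hne)
    · intro k l
      by_cases hkl : k = l
      · simpa [tdiag, hkl] using ((L l).isTransition i j).2 0 0
      · exact Or.inr fun x _ => if_neg hkl
  self i x hx := by
    simp [(L _).self i x hx, tone, tdiag]
  comp i j k x hx := by
    funext a b
    have h := fun c => congrFun (congrFun ((L c).comp i j k x hx) 0) 0
    obtain ⟨l, hl, -⟩ := (((L a).isTransition j k).1 x ⟨hx.1.2, hx.2⟩).1 0
    have h1 : tmul (tdiag fun k' => (L k').M j k x 0 0) (tdiag fun k' => (L k').M i j x 0 0) a b =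
        (L a).M j k x 0 0 + tdiag (fun k' => (L k').M i j x 0 0) a b := by
      apply le_antisymm
      · refine Finset.sup_le fun c _ => ?_
        by_cases hc : a = c
        · subst hc; simp [tdiag]
        · simp [tdiag, hc]
      · refine le_trans (le_of_eq ?_) (Finset.le_sup (Finset.mem_univ a))
        simp [tdiag]
    rw [h1]
    by_cases hab : a = b
    · subst hab
      have := h a
      simp only [tmul, Finset.univ_unique, Fin.default_eq_zero, Finset.sup_singleton] at this
      simp [tdiag, this]
    · simp [tdiag, hab]

end bundles

/-! ### Tropical projective space -/

/-- `𝕋ⁿ⁺¹` without the point `(-∞, …, -∞)`. -/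
abbrev Punctured (n : ℕ) : Type := {x : Fin (n + 1) → TNum // ∃ i, x i ≠ ⊥}

/-- Tropical scaling by elements of `𝕋ˣ = ℝ`. -/
def scaling (n : ℕ) : Setoid (Punctured n) where
  r x y := ∃ c : ℝ, ∀ i, x.1 i = (c : TNum) + y.1 i
  iseqv :=
    { refl := fun x => ⟨0, fun i => by simp⟩
      symm := by
        rintro x y ⟨c, h⟩
        refine ⟨-c, fun i => ?_⟩
        rw [h i, ← add_assoc, ← WithBot.coe_add, neg_add_cancel, WithBot.coe_zero, zero_add]
      trans := by
        rintro x y z ⟨c, h⟩ ⟨d, h'⟩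
        refine ⟨c + d, fun i => ?_⟩
        rw [h i, h' i, WithBot.coe_add, add_assoc] }

/-- Tropical projective space `𝕋ℙⁿ`, with the quotient topology. -/
def TP (n : ℕ) : Type := Quotient (scaling n)

instance (n : ℕ) : TopologicalSpace (TP n) :=
  inferInstanceAs (TopologicalSpace (Quotient (scaling n)))

namespace TP

variable {n : ℕ}

/-- The point `[x₀ : ⋯ : xₙ]`. -/
def mk (x : Punctured n) : TP n := Quotient.mk (scaling n) x

lemma isQuotientMap_mk : IsQuotientMap (mk : Punctured n → TP n) := isQuotientMap_quotient_mk'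

/-- The point `[x₀ : ⋯ : xₙ]` for real numbers `xᵢ`. -/
def ofReal (x : Fin (n + 1) → ℝ) : TP n := mk ⟨fun i => (x i : TNum), 0, WithBot.coe_ne_bot⟩

/-- The regular invertible functions on `𝕋ℙⁿ`: the continuous real functions that are, locally and
at the points with finite coordinates, integer affine linear in any of the coordinate systems
`(x_j - x_i)_j`, that is, of the form `∑ m_j x_j + c` with integers `m_j` of sum `0` and `c` real. -/
instance tropicalSpace : TropicalSpace (TP n) where
  RegAt f p := (∀ᶠ q in 𝓝 p, ContinuousAt f q) ∧ ∃ (m : Fin (n + 1) → ℤ) (c : ℝ), ∑ j, m j = 0 ∧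
    ∀ᶠ q in 𝓝 p, ∀ x : Fin (n + 1) → ℝ, q = ofReal x → f q = ∑ j, (m j : ℝ) * x j + c
  congr := by
    rintro f g p h ⟨hc, m, c, hm, hf⟩
    refine ⟨?_, m, c, hm, ?_⟩
    · filter_upwards [hc, h.eventuallyEq_nhds] with q h1 h2
      exact h1.congr h2
    · filter_upwards [hf, h] with q h1 h2
      rwa [← h2]
  eventually := by
    rintro f p ⟨hc, m, c, hm, hf⟩
    filter_upwards [hc.eventually_nhds, hf.eventually_nhds] with q h1 h2
    exact ⟨h1, m, c, hm, h2⟩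
  continuousAt h := h.1.self_of_nhds
  const c p := ⟨Eventually.of_forall fun _ => continuousAt_const, 0, c, by simp, by simp⟩
  add := by
    rintro f g p ⟨hc, m, c, hm, hf⟩ ⟨hc', m', c', hm', hg⟩
    refine ⟨?_, m + m', c + c', by simp [Finset.sum_add_distrib, hm, hm'], ?_⟩
    · filter_upwards [hc, hc'] with q h1 h2
      exact h1.add h2
    · filter_upwards [hf, hg] with q h1 h2 x hx
      simp only [h1 x hx, h2 x hx, Pi.add_apply, Int.cast_add, add_mul, Finset.sum_add_distrib]
      ring
  neg := by
    rintro f p ⟨hc, m, c, hm, hf⟩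
    refine ⟨?_, -m, -c, by simp [hm], ?_⟩
    · filter_upwards [hc] with q h1
      exact h1.neg
    · filter_upwards [hf] with q h1 x hx
      simp only [h1 x hx, Pi.neg_apply, Int.cast_neg, neg_mul, Finset.sum_neg_distrib]
      ring

/-- The condition `x_i ≠ -∞` on `[x₀ : ⋯ : xₙ]`. -/
def Finite (i : Fin (n + 1)) : TP n → Prop :=
  Quotient.lift (fun x : Punctured n => x.1 i ≠ ⊥) (by
    rintro x y ⟨c, h⟩
    simp [h i])

/-- The function `x_j - x_i` on `U_i ∩ U_j` (and, irrelevantly, `0` elsewhere). -/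
def diff (i j : Fin (n + 1)) : TP n → ℝ :=
  Quotient.lift (fun x : Punctured n =>
    if x.1 i ≠ ⊥ ∧ x.1 j ≠ ⊥ then (x.1 j).unbotD 0 - (x.1 i).unbotD 0 else 0) (by
    rintro x y ⟨c, h⟩
    have hb : ∀ k, x.1 k ≠ ⊥ ↔ y.1 k ≠ ⊥ := fun k => by simp [h k]
    simp only [hb]
    split_ifs with hy
    · obtain ⟨a, ha⟩ := WithBot.ne_bot_iff_exists.1 hy.1
      obtain ⟨b, hb⟩ := WithBot.ne_bot_iff_exists.1 hy.2
      rw [h i, h j, ← ha, ← hb, ← WithBot.coe_add, ← WithBot.coe_add]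
      simp only [WithBot.unbotD_coe]
      ring
    · rfl)

lemma isOpenEmbedding_coe : IsOpenEmbedding ((↑) : ℝ → TNum) := by
  have hr : range ((↑) : ℝ → TNum) = Ioi ⊥ := by
    ext x
    cases x <;> simp
  refine ⟨WithBot.coe_strictMono.isEmbedding_of_ordConnected ?_, ?_⟩
  · rw [hr]; exact ordConnected_Ioi
  · rw [hr]; exact isOpen_Ioi

lemma isOpen_ne_bot : IsOpen {t : TNum | t ≠ ⊥} := isOpen_ne

lemma continuousAt_unbotD {t : TNum} (ht : t ≠ ⊥) :
    ContinuousAt (fun t : TNum => t.unbotD 0) t := by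
  obtain ⟨a, rfl⟩ := WithBot.ne_bot_iff_exists.1 ht
  rw [← isOpenEmbedding_coe.continuousAt_iff]
  exact continuousAt_id

/-- The standard affine chart domain `U_i = {x_i ≠ -∞}`. -/
def chartDomain (i : Fin (n + 1)) : Opens (TP n) where
  carrier := {p | Finite i p}
  is_open' := by
    rw [← isQuotientMap_mk.isOpen_preimage]
    have h : Continuous fun x : Punctured n => x.1 i :=
      (continuous_apply i).comp continuous_subtype_val
    exact isOpen_ne_bot.preimage h

lemma chartDomain_cover (p : TP n) : ∃ i, p ∈ chartDomain i := by
  induction p using Quotient.inductionOn with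
  | h x => exact x.2

lemma continuousOn_diff (i j : Fin (n + 1)) :
    ContinuousOn (diff i j) ((chartDomain i : Set (TP n)) ∩ chartDomain j) := by
  rw [isQuotientMap_mk.continuousOn_isOpen_iff
    ((chartDomain i).isOpen.inter (chartDomain j).isOpen)]
  rintro x ⟨hi, hj⟩
  have hcont : ∀ k, x.1 k ≠ ⊥ → ContinuousAt (fun y : Punctured n => (y.1 k).unbotD 0) x := by
    intro k hk
    exact ContinuousAt.comp (f := fun y : Punctured n => y.1 k) (continuousAt_unbotD hk)
      ((continuous_apply k).comp continuous_subtype_val).continuousAt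
  have h := ((hcont j hj).sub (hcont i hi)).continuousWithinAt
    (s := mk ⁻¹' ((chartDomain i : Set (TP n)) ∩ chartDomain j))
  refine h.congr_of_mem ?_ ⟨hi, hj⟩
  rintro y ⟨hyi, hyj⟩
  exact if_pos ⟨hyi, hyj⟩

lemma diff_ofReal (i j : Fin (n + 1)) (x : Fin (n + 1) → ℝ) :
    diff i j (ofReal x) = x j - x i := by
  change (if (x i : TNum) ≠ ⊥ ∧ (x j : TNum) ≠ ⊥ then
    (x j : TNum).unbotD 0 - (x i : TNum).unbotD 0 else 0) = x j - x i
  simp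

lemma regularOn_diff (i j : Fin (n + 1)) :
    RegularOn ((chartDomain i : Set (TP n)) ∩ chartDomain j) (diff i j) := by
  intro p hp
  have hopen := (chartDomain i).isOpen.inter (chartDomain j).isOpen
  refine ⟨?_, Pi.single j 1 - Pi.single i 1, 0, by simp, ?_⟩
  · filter_upwards [hopen.mem_nhds hp] with q hq
    exact (continuousOn_diff i j).continuousAt (hopen.mem_nhds hq)
  · refine Eventually.of_forall ?_
    rintro q x rfl
    rw [diff_ofReal]
    simp [Pi.single_apply, sub_mul, Finset.sum_sub_distrib]

lemma diff_self (i : Fin (n + 1)) (p : TP n) : diff i i p = 0 := by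
  induction p using Quotient.inductionOn with
  | h x => simp [diff]

lemma diff_add_diff (i j k : Fin (n + 1)) {p : TP n}
    (hp : p ∈ (chartDomain i : Set (TP n)) ∩ chartDomain j ∩ chartDomain k) :
    diff j k p + diff i j p = diff i k p := by
  induction p using Quotient.inductionOn with
  | h x =>
    obtain ⟨⟨hi, hj⟩, hk⟩ := hp
    change (if _ then _ else _) + (if _ then _ else _) = (if _ then _ else _)
    rw [if_pos ⟨hj, hk⟩, if_pos ⟨hi, hj⟩, if_pos ⟨hi, hk⟩]
    ring

/-- The transition maps `M_ij(x) = d (x_j - x_i)` over the standard cover, which define the line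
bundle `𝒪(d)` on `𝕋ℙⁿ`. -/
def serreData (n : ℕ) (d : ℤ) : TransitionData (chartDomain (n := n)) 1 where
  cover := chartDomain_cover
  M i j p := fun _ _ => ((d * diff i j p : ℝ) : TNum)
  isTransition i j := by
    refine ⟨fun p _ => ⟨fun _ => ⟨0, WithBot.coe_ne_bot, fun _ _ => Subsingleton.elim _ _⟩,
      fun _ => ⟨0, WithBot.coe_ne_bot, fun _ _ => Subsingleton.elim _ _⟩⟩, fun _ _ => Or.inl ?_⟩
    exact ⟨fun p => d * diff i j p, fun p hp => regAt_zsmul (regularOn_diff i j p hp) d,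
      fun _ _ => rfl⟩
  self i p _ := by
    funext a b
    simp [diff_self, tone, tdiag, Subsingleton.elim a b]
  comp i j k p hp := by
    funext a b
    simp only [tmul, Finset.univ_unique, Finset.sup_singleton]
    rw [← diff_add_diff i j k hp, mul_add, WithBot.coe_add]

/-- The line bundle `𝒪(d)` on `𝕋ℙⁿ`. -/
def O (n : ℕ) (d : ℤ) : TropicalVectorBundle (TP n) 1 := (serreData n d).toBundle

/-- The bundle `𝒪(d₁) ⊕ ⋯ ⊕ 𝒪(d_r)` on `𝕋ℙⁿ`. -/
def sumO (n : ℕ) {r : ℕ} (d : Fin r → ℤ) : TropicalVectorBundle (TP n) r :=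
  (directSum chartDomain_cover fun k => serreData n (d k)).toBundle

end TP

end

end TropVB

/-!
The tropical projective line is the interval `[-∞, ∞]` with coordinate `x₁ - x₀`, and a tropical
vector bundle has a monomial structure group: two systems of fibre coordinates that are compatible
with the bundle (*frames*) differ, near a point, by a fixed permutation and by regular invertible
functions (`TropicalVectorBundle.FrameAt.monomialAt`). Near a real point `t` the latter are integer
affine functions of the coordinate (`TP.exists_affine`), and these are regular invertible on all
of `ℝ`.

Hence a frame over `[-∞, s]` can be extended across any strip over which the bundle is trivial:
the frame of the strip is changed by the permutation and the affine functions that compare the two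
at `s`, after which both agree near `s` and glue. So the set of `t` for which there is a frame over
`[-∞, t]` is open and closed in `ℝ`, and it is nonempty because of a trivialization at `-∞`; this is
`exists_frame_compl_upper`. For large `t`, the frame over `[-∞, t]` is compared at `t` with a
trivialization at `∞`. The permutation and the constants can be absorbed in the latter, so that
there are frames over `U₀ = [-∞, ∞)` and `U₁ = (-∞, ∞]` that differ by integer multiples `dₖ` of the
coordinate (`exists_frames`). These are the transition maps of `𝒪(d₁) ⊕ ⋯ ⊕ 𝒪(dₙ)`, and
`isomorphic_toBundle` turns frames with given transition maps into an isomorphism with the glued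
bundle; compactness of the base gives the finite cover in the definition of a morphism.
-/

namespace TropVB

open Set Filter Topology TopologicalSpace Bundle TropicalSpace

/-! ### Monomial changes of fibre coordinates -/

section general

variable {X : Type*} [TopologicalSpace X] [TropicalSpace X] {n : ℕ} {Z : Type*}

/-- Near the fibre of `proj` over `x`, the tuples of functions `u` and `v` differ by a
monomial change of coordinates: `u k = g k + v (σ k)` for a fixed permutation `σ` and functions
`g k` pulled back from `X` that are regular invertible at `x`. -/
def MonomialAt (proj : Z → X) (u v : Z → Fin n → ℝ) (x : X) : Prop :=
  ∃ (σ : Equiv.Perm (Fin n)) (g : Fin n → X → ℝ), (∀ k, RegAt (g k) x) ∧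
    ∀ᶠ y in 𝓝 x, ∀ p, proj p = y → ∀ k, u p k = g k y + v p (σ k)

namespace MonomialAt

variable {proj : Z → X} {u v w : Z → Fin n → ℝ} {x : X}

lemma of_eventually_eq (h : ∀ᶠ y in 𝓝 x, ∀ p, proj p = y → u p = v p) :
    MonomialAt proj u v x := by
  refine ⟨1, fun _ _ => 0, fun _ => const 0 x, ?_⟩
  filter_upwards [h] with y hy p hp k
  simp [hy p hp]

lemma refl (proj : Z → X) (u : Z → Fin n → ℝ) (x : X) : MonomialAt proj u u x :=
  of_eventually_eq (Eventually.of_forall fun _ _ _ => rfl)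

lemma symm (h : MonomialAt proj u v x) : MonomialAt proj v u x := by
  obtain ⟨σ, g, hg, h⟩ := h
  refine ⟨σ⁻¹, fun k y => -g (σ⁻¹ k) y, fun k => neg (hg _), ?_⟩
  filter_upwards [h] with y hy p hp k
  simp [hy p hp]

lemma trans (h : MonomialAt proj u v x) (h' : MonomialAt proj v w x) :
    MonomialAt proj u w x := by
  obtain ⟨σ, g, hg, h⟩ := h
  obtain ⟨τ, f, hf, h'⟩ := h'
  refine ⟨σ.trans τ, fun k y => g k y + f (σ k) y, fun k => add (hg k) (hf _), ?_⟩
  filter_upwards [h, h'] with y hy hy' p hp k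
  simp [hy p hp, hy' p hp, add_assoc]

end MonomialAt

/-- A transition map is a monomial change of coordinates: the square matrices with exactly one
finite entry in each row and column are the monomial ones. -/
lemma IsTransition.exists_perm {W : Set X} {M : X → TMat n n} (h : IsTransition W M)
    {p : X} (hp : p ∈ W) : ∃ (σ : Equiv.Perm (Fin n)) (g : Fin n → X → ℝ),
      (∀ k, RegularOn W (g k)) ∧ ∀ x ∈ W, ∀ a k, act (M x) a k = g k x + a (σ k) := by
  obtain ⟨σ, g, hg, hM⟩ := h.normalForm hp
  have hσ : Function.Injective σ := by
    intro k l hkl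
    refine ((h.1 p hp).2 (σ k)).unique ?_ ?_
    · rw [hM p hp]; simp
    · rw [hM p hp]; simp [hkl]
  exact ⟨Equiv.ofBijective σ (Finite.injective_iff_bijective.1 hσ), g, hg,
    fun x hx a k => act_of_normalForm (hM x hx) a k⟩

namespace TropicalVectorBundle

variable (E : TropicalVectorBundle X n)

/-- The fibre coordinates of the `i`-th local trivialization. -/
def coord (i : Fin E.s) (p : E.Total) : Fin n → ℝ := (E.triv i p).2

lemma monomialAt_coord (i j : Fin E.s) {x : X} (hi : x ∈ (E.triv i).baseSet)
    (hj : x ∈ (E.triv j).baseSet) : MonomialAt E.proj (E.coord j) (E.coord i) x := by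
  obtain ⟨M, hM, hact⟩ := E.transition i j
  obtain ⟨σ, g, hg, hMg⟩ := hM.exists_perm ⟨hi, hj⟩
  refine ⟨σ, g, fun k => hg k x ⟨hi, hj⟩, ?_⟩
  filter_upwards [(E.triv i).open_baseSet.mem_nhds hi, (E.triv j).open_baseSet.mem_nhds hj]
    with y hyi hyj
  rintro p rfl k
  have h := hact _ ⟨hyi, hyj⟩ (E.coord i p)
  rw [coord, (E.triv i).symm_apply_mk_proj ((E.triv i).mem_source.2 hyi)] at h
  rw [coord, h]
  exact hMg _ ⟨hyi, hyj⟩ _ k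

/-- The functions `u` are fibre coordinates near `x` that are compatible with the local
trivializations of the bundle. -/
def FrameAt (u : E.Total → Fin n → ℝ) (x : X) : Prop :=
  ∃ i, x ∈ (E.triv i).baseSet ∧ MonomialAt E.proj u (E.coord i) x

variable {E} {u v : E.Total → Fin n → ℝ} {x : X}

lemma frameAt_coord (i : Fin E.s) (hx : x ∈ (E.triv i).baseSet) : E.FrameAt (E.coord i) x :=
  ⟨i, hx, .refl _ _ _⟩

lemma FrameAt.of_monomialAt (hv : E.FrameAt v x) (h : MonomialAt E.proj u v x) :
    E.FrameAt u x := by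
  obtain ⟨i, hi, hv⟩ := hv
  exact ⟨i, hi, h.trans hv⟩

lemma FrameAt.congr (hv : E.FrameAt v x) (h : ∀ᶠ y in 𝓝 x, ∀ p, E.proj p = y → u p = v p) :
    E.FrameAt u x :=
  hv.of_monomialAt (.of_eventually_eq h)

lemma FrameAt.monomialAt (hu : E.FrameAt u x) (hv : E.FrameAt v x) :
    MonomialAt E.proj u v x := by
  obtain ⟨i, hi, hu⟩ := hu
  obtain ⟨j, hj, hv⟩ := hv
  exact hu.trans ((E.monomialAt_coord j i hj hi).trans hv.symm)

end TropicalVectorBundle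

/-! ### Isomorphisms from local monomial forms -/

/-- Monomial changes of coordinates on `X × ℝⁿ` preserve regular invertible functions: an integer
linear form is turned into an integer linear form plus a regular invertible function on `X`. -/
lemma regAt_monomial (σ : Equiv.Perm (Fin n)) {g : Fin n → X → ℝ} {x : X} (a : Fin n → ℝ)
    (hg : ∀ k, RegAt (g k) x) {f : X × (Fin n → ℝ) → ℝ}
    (hf : RegAt f (x, fun k => g k x + a (σ k))) :
    RegAt (fun q : X × (Fin n → ℝ) => f (q.1, fun k => g k q.1 + q.2 (σ k))) (x, a) := by
  obtain ⟨φ, m, hφ, hfm⟩ := hf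
  have hreg : RegAt (fun q : X × (Fin n → ℝ) =>
      φ q.1 + ∑ k, (m k : ℝ) * (g k q.1 + q.2 (σ k))) (x, a) := by
    refine add (regAt_fst hφ) (regAt_sum _ fun k _ => regAt_zsmul (add ?_ (regAt_coord _ _)) _)
    exact regAt_fst (hg k)
  have hcont : ContinuousAt (fun q : X × (Fin n → ℝ) =>
      (q.1, fun k => g k q.1 + q.2 (σ k))) (x, a) := by
    refine continuousAt_fst.prodMk (continuousAt_pi.2 fun k => ?_)
    have h1 : ContinuousAt (fun q : X × (Fin n → ℝ) => g k q.1) (x, a) :=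
      ContinuousAt.comp (f := Prod.fst) (continuousAt (hg k)) continuousAt_fst
    exact h1.add (by fun_prop)
  refine congr ?_ hreg
  filter_upwards [hcont.eventually hfm] with q h
  exact h.symm

variable {E : TropicalVectorBundle X n} {F : TropicalVectorBundle X n} {Ψ : E.Total → F.Total}

/-- A map over `X` that is given by monomial changes of coordinates in local trivializations. -/
def IsLocallyMonomial (E F : TropicalVectorBundle X n) (Ψ : E.Total → F.Total) : Prop :=
  (∀ p, F.proj (Ψ p) = E.proj p) ∧ ∀ x, ∃ i j, x ∈ (E.triv i).baseSet ∧
    x ∈ (F.triv j).baseSet ∧ MonomialAt E.proj (fun p => F.coord j (Ψ p)) (E.coord i) x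

/-- The monomial form of the map over an open set `V`, on which the functions `g` are regular
invertible, with the value in the trivialization of `F` as a point of `X × ℝⁿ`. -/
lemma IsLocallyMonomial.exists_local (h : IsLocallyMonomial E F Ψ) (x : X) :
    ∃ (i : Fin E.s) (j : Fin F.s) (σ : Equiv.Perm (Fin n)) (g : Fin n → X → ℝ) (V : Opens X),
      x ∈ V ∧ (V : Set X) ⊆ (E.triv i).baseSet ∩ (F.triv j).baseSet ∧
      (∀ k, RegularOn V (g k)) ∧ ∀ y ∈ V, ∀ p, E.proj p = y →
        F.triv j (Ψ p) = (y, fun k => g k y + (E.triv i p).2 (σ k)) := by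
  obtain ⟨hπ, h⟩ := h
  obtain ⟨i, j, hi, hj, σ, g, hg, h⟩ := h x
  have hev := h.and (((E.triv i).open_baseSet.inter (F.triv j).open_baseSet).mem_nhds ⟨hi, hj⟩)
  have hreg : ∀ᶠ y in 𝓝 x, ∀ k, RegAt (g k) y := eventually_all.2 fun k => eventually (hg k)
  obtain ⟨V, hV, hVo, hxV⟩ := eventually_nhds_iff.1 (hev.and hreg)
  refine ⟨i, j, σ, g, ⟨V, hVo⟩, hxV, fun y hy => (hV y hy).1.2, fun k y hy => (hV y hy).2 k, ?_⟩
  rintro _ hy p rfl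
  have hmem : Ψ p ∈ (F.triv j).source := by
    rw [(F.triv j).mem_source, hπ]; exact (hV _ hy).1.2.2
  refine Prod.ext ?_ (funext fun k => (hV _ hy).1.1 p rfl k)
  rw [(F.triv j).coe_fst hmem, hπ]

/-- Continuity and the pullback of regular invertible functions are checked near each point in local
trivializations, where they hold for monomial changes of coordinates. -/
lemma IsLocallyMonomial.isTropicalMap (h : IsLocallyMonomial E F Ψ) : IsTropicalMap Ψ := by
  have key : ∀ p, ContinuousAt Ψ p ∧ ∀ f : F.Total → ℝ, RegAt f (Ψ p) → RegAt (f ∘ Ψ) p := by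
    intro p
    obtain ⟨i, j, σ, g, V, hxV, hV, hg, hloc⟩ := h.exists_local (E.proj p)
    have hpE : p ∈ (E.triv i).source := (E.triv i).mem_source.2 (hV hxV).1
    have hnear : ∀ᶠ q in 𝓝 p, E.proj q ∈ V :=
      E.isTropicalMap_proj.1.continuousAt.eventually (V.isOpen.mem_nhds hxV)
    have hmem : ∀ q, E.proj q ∈ V → Ψ q ∈ (F.triv j).source := fun q hq => by
      rw [(F.triv j).mem_source, h.1]; exact (hV hq).2
    have hcont : ContinuousAt Ψ p := by
      have h1 : Tendsto Ψ (𝓝 p) (𝓝 (Ψ p)) := by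
        rw [(F.triv j).tendsto_nhds_iff (hmem p hxV)]
        constructor
        · simp only [Function.comp_def, h.1]
          exact E.isTropicalMap_proj.1.continuousAt
        · have h2 : ContinuousAt (fun q => fun k => g k (E.proj q) + (E.triv i q).2 (σ k)) p := by
            refine continuousAt_pi.2 fun k => ContinuousAt.add ?_ ?_
            · exact ContinuousAt.comp (f := E.proj) (continuousAt (hg k _ hxV))
                E.isTropicalMap_proj.1.continuousAt
            · have h3 : ContinuousAt (E.triv i) p := (E.triv i).continuousAt hpE
              exact (continuous_apply (σ k)).continuousAt.comp (continuousAt_snd.comp h3)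
          have h4 : ContinuousAt (fun q => (F.triv j (Ψ q)).2) p := by
            refine h2.congr_of_eventuallyEq ?_
            filter_upwards [hnear] with q hq
            rw [hloc _ hq q rfl]
          exact h4
      exact h1
    refine ⟨hcont, fun f hf => ?_⟩
    have hf' : RegAt (f ∘ (F.triv j).toOpenPartialHomeomorph.symm) (F.triv j (Ψ p)) := by
      rw [← F.regAt_triv j _ (hmem p hxV)]
      refine congr ?_ hf
      filter_upwards [(F.triv j).open_source.mem_nhds (hmem p hxV)] with q hq
      exact congrArg f ((F.triv j).toOpenPartialHomeomorph.left_inv hq).symm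
    rw [hloc _ hxV p rfl] at hf'
    have hf'' := regAt_monomial σ _ (fun k => hg k _ hxV) hf'
    rw [(E.triv i).mk_proj_snd hpE, ← E.regAt_triv i p hpE] at hf''
    refine congr ?_ hf''
    filter_upwards [hnear] with q hq
    have hq' : q ∈ (E.triv i).source := (E.triv i).mem_source.2 (hV hq).1
    have h5 := hloc _ hq q rfl
    simp only [Function.comp_apply, (E.triv i).coe_fst hq']
    rw [← h5]
    exact congrArg f ((F.triv j).toOpenPartialHomeomorph.left_inv (hmem q hq))
  exact ⟨continuous_iff_continuousAt.2 fun p => (key p).1, fun f p => (key p).2 f⟩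

/-- Compactness of the base provides the finite cover that a bundle morphism requires. -/
lemma IsLocallyMonomial.isBundleMorphism [CompactSpace X] (h : IsLocallyMonomial E F Ψ) :
    IsBundleMorphism E F Ψ := by
  refine ⟨h.isTropicalMap, h.1, ?_⟩
  choose i j σ g V hxV hV hg hloc using h.exists_local
  obtain ⟨s, hs⟩ := CompactSpace.elim_nhds_subcover (fun x => (V x : Set X))
    fun x => (V x).isOpen.mem_nhds (hxV x)
  let c : Fin s.card → X := fun k => (s.equivFin.symm k : X)
  refine ⟨s.card, fun k => V (c k), fun k => i (c k), fun k => j (c k),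
    fun k x a b => if b = σ (c k) a then ((g (c k) a x : ℝ) : TNum) else ⊥, fun x => ?_,
    fun k => ⟨hV (c k), ?_, ?_, ?_⟩⟩
  · have hx : x ∈ ⋃ y ∈ s, (V y : Set X) := hs ▸ mem_univ x
    obtain ⟨y, hy, hxy⟩ := mem_iUnion₂.1 hx
    exact ⟨s.equivFin ⟨y, hy⟩, by simpa [c] using hxy⟩
  · intro x _ a b b' hb hb'
    simp only [ne_eq, ite_eq_right_iff, not_forall] at hb hb'
    rw [hb.1, hb'.1]
  · intro a b
    by_cases hab : b = σ (c k) a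
    · exact Or.inl ⟨g (c k) a, hg (c k) a, fun x _ => if_pos hab⟩
    · exact Or.inr fun x _ => if_neg hab
  · intro x hx a
    have hmem : (x, a) ∈ (E.triv (i (c k))).target :=
      (E.triv (i (c k))).mem_target.2 (hV (c k) hx).1
    rw [hloc (c k) x hx _ ((E.triv (i (c k))).proj_symm_apply hmem),
      (E.triv (i (c k))).apply_symm_apply hmem]
    exact Prod.ext rfl (funext fun l => (act_of_normalForm (σ := σ (c k))
      (g := fun l => g (c k) l x) (fun _ _ => rfl) a l).symm)

lemma IsLocallyMonomial.bijective (h : IsLocallyMonomial E F Ψ) : Function.Bijective Ψ := by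
  constructor
  · intro p q hpq
    obtain ⟨i, j, σ, g, V, hxV, hV, -, hloc⟩ := h.exists_local (E.proj p)
    have hproj : E.proj q = E.proj p := by rw [← h.1, ← h.1, hpq]
    have hp : p ∈ (E.triv i).source := (E.triv i).mem_source.2 (hV hxV).1
    have hq : q ∈ (E.triv i).source := (E.triv i).mem_source.2 (hproj ▸ (hV hxV).1)
    have h1 := hloc _ hxV p rfl
    rw [hpq, hloc _ hxV q hproj] at h1
    refine (E.triv i).injOn hp hq (Prod.ext ?_ (funext fun k => ?_))
    · exact ((E.triv i).coe_fst hp).trans (hproj.symm.trans ((E.triv i).coe_fst hq).symm)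
    · have h2 := congrFun (Prod.ext_iff.1 h1).2 (σ.symm k)
      simpa using h2.symm
  · intro q
    obtain ⟨i, j, σ, g, V, hxV, hV, -, hloc⟩ := h.exists_local (F.proj q)
    let a : Fin n → ℝ := fun k => (F.triv j q).2 (σ.symm k) - g (σ.symm k) (F.proj q)
    have hmem : (F.proj q, a) ∈ (E.triv i).target := (E.triv i).mem_target.2 (hV hxV).1
    have hp := (E.triv i).proj_symm_apply hmem
    refine ⟨(E.triv i).toOpenPartialHomeomorph.symm (F.proj q, a), ?_⟩
    have hq : q ∈ (F.triv j).source := (F.triv j).mem_source.2 (hV hxV).2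
    refine (F.triv j).injOn ?_ hq ?_
    · rw [(F.triv j).mem_source, h.1, hp]; exact (hV hxV).2
    · refine (hloc _ hxV _ hp).trans ?_
      rw [(E.triv i).apply_symm_apply hmem]
      refine Prod.ext ((F.triv j).coe_fst hq).symm (funext fun k => ?_)
      simp [a]

lemma IsLocallyMonomial.of_inverse (h : IsLocallyMonomial E F Ψ) {Θ : F.Total → E.Total}
    (hΘ : Function.RightInverse Θ Ψ) : IsLocallyMonomial F E Θ := by
  have hproj : ∀ q, E.proj (Θ q) = F.proj q := fun q => by rw [← h.1, hΘ]
  refine ⟨hproj, fun x => ?_⟩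
  obtain ⟨i, j, hi, hj, hm⟩ := h.2 x
  obtain ⟨σ, g, hg, hm⟩ := hm.symm
  refine ⟨j, i, hj, hi, σ, g, hg, ?_⟩
  filter_upwards [hm] with y hy q hq k
  have := hy (Θ q) ((hproj q).trans hq) k
  rwa [hΘ q] at this

lemma IsLocallyMonomial.isomorphic [CompactSpace X] (h : IsLocallyMonomial E F Ψ) :
    Isomorphic E F := by
  let e := Equiv.ofBijective Ψ h.bijective
  exact ⟨Ψ, e.symm, h.isBundleMorphism,
    (h.of_inverse e.apply_symm_apply).isBundleMorphism, e.symm_apply_apply, e.apply_symm_apply⟩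

/-- A bundle with frames over the members of a cover whose changes of frame are the given
transition maps is isomorphic to the bundle glued from these. -/
lemma isomorphic_toBundle [CompactSpace X] {s : ℕ} {U : Fin s → Opens X}
    (T : TransitionData U n) (u : Fin s → E.Total → Fin n → ℝ)
    (hu : ∀ i, ∀ x ∈ U i, E.FrameAt (u i) x)
    (hM : ∀ i j, ∀ p, E.proj p ∈ U i → E.proj p ∈ U j →
      u j p = act (T.M i j (E.proj p)) (u i p)) : Isomorphic E T.toBundle := by
  choose c hc using T.cover
  let Ψ : E.Total → T.core.TotalSpace := fun p =>
    (T.chart (c (E.proj p))).toOpenPartialHomeomorph.symm (E.proj p, u (c (E.proj p)) p)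
  -- By compatibility with the transition maps, `Ψ` is given by `u i` in every chart `i`.
  have hΨ : ∀ i p, E.proj p ∈ U i → T.chart i (Ψ p) = (E.proj p, u i p) := fun i p hp => by
    rw [hM _ i p (hc _) hp]
    exact T.chart_chart_symm _ i ⟨hc _, hp⟩ _
  refine IsLocallyMonomial.isomorphic (F := T.toBundle) (Ψ := Ψ) ⟨fun p => rfl, fun x => ?_⟩
  obtain ⟨i, hi, hm⟩ := hu (c x) x (hc x)
  refine ⟨i, c x, hi, hc x, .trans (.of_eventually_eq ?_) hm⟩
  filter_upwards [(U (c x)).isOpen.mem_nhds (hc x)] with y hy p hp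
  exact congrArg Prod.snd (hΨ _ p (hp ▸ hy))

end general

/-! ### The tropical projective line as an interval -/

namespace TP

/-- The end `[0 : -∞]` of the tropical projective line. -/
def leftEnd : TP 1 := mk ⟨![0, ⊥], 0, by simp⟩

/-- The end `[-∞ : 0]` of the tropical projective line. -/
def rightEnd : TP 1 := mk ⟨![⊥, 0], 1, by simp⟩

/-- The point `[0 : t]` of the tropical projective line. -/
def point (t : ℝ) : TP 1 := ofReal ![0, t]

/-- The points `[x₀ : x₁]` with `x₁ - x₀ < t`. -/
def lower (t : ℝ) : Set (TP 1) :=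
  {p | Quotient.lift (fun x : Punctured 1 => x.1 1 < x.1 0 + (t : TNum)) (by
    rintro x y ⟨c, h⟩
    simp only [h, add_assoc]
    exact propext (WithBot.add_lt_add_iff_left WithBot.coe_ne_bot)) p}

/-- The points `[x₀ : x₁]` with `t < x₁ - x₀`. -/
def upper (t : ℝ) : Set (TP 1) :=
  {p | Quotient.lift (fun x : Punctured 1 => x.1 0 + (t : TNum) < x.1 1) (by
    rintro x y ⟨c, h⟩
    simp only [h, add_assoc]
    exact propext (WithBot.add_lt_add_iff_left WithBot.coe_ne_bot)) p}

lemma ofReal_eq_point (x : Fin 2 → ℝ) : ofReal x = point (x 1 - x 0) := by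
  refine Quotient.sound ⟨x 0, fun i => ?_⟩
  fin_cases i
  · simp
  · change ((x 1 : ℝ) : TNum) = (x 0 : TNum) + ((x 1 - x 0 : ℝ) : TNum)
    rw [← WithBot.coe_add, add_sub_cancel]

lemma eq_end_or_eq_point (p : TP 1) : p = leftEnd ∨ p = rightEnd ∨ ∃ t, p = point t := by
  induction p using Quotient.inductionOn with
  | h x =>
    obtain ⟨x, hx⟩ := x
    have hx' : x 0 ≠ ⊥ ∨ x 1 ≠ ⊥ := by
      obtain ⟨i, hi⟩ := hx
      fin_cases i
      · exact Or.inl hi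
      · exact Or.inr hi
    rcases h0 : x 0 with _ | a
    · rcases h1 : x 1 with _ | b
      · exact absurd hx' (not_or.2 ⟨fun h => h h0, fun h => h h1⟩)
      · refine Or.inr (Or.inl (Quotient.sound ⟨b, fun i => ?_⟩))
        fin_cases i
        · exact h0
        · exact h1.trans (add_zero _).symm
    · rcases h1 : x 1 with _ | b
      · refine Or.inl (Quotient.sound ⟨a, fun i => ?_⟩)
        fin_cases i
        · exact h0.trans (add_zero _).symm
        · exact h1
      · refine Or.inr (Or.inr ⟨b - a, ?_⟩)
        rw [← show ofReal ![a, b] = point (b - a) from ofReal_eq_point _]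
        refine Quotient.sound ⟨0, fun i => ?_⟩
        fin_cases i
        · exact h0.trans (zero_add _).symm
        · exact h1.trans (zero_add _).symm

section membership

variable (s t : ℝ)

@[simp] lemma leftEnd_mem_lower : leftEnd ∈ lower t := by
  change (⊥ : TNum) < 0 + (t : TNum)
  simp

@[simp] lemma leftEnd_notMem_upper : leftEnd ∉ upper t := by
  change ¬ (0 + (t : TNum) < ⊥)
  simp

@[simp] lemma rightEnd_mem_upper : rightEnd ∈ upper t := by
  change (⊥ : TNum) + (t : TNum) < 0
  simp

@[simp] lemma rightEnd_notMem_lower : rightEnd ∉ lower t := by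
  change ¬ (0 < (⊥ : TNum) + (t : TNum))
  simp

@[simp] lemma point_mem_lower : point s ∈ lower t ↔ s < t := by
  change (s : TNum) < ((0 : ℝ) : TNum) + (t : TNum) ↔ s < t
  rw [← WithBot.coe_add, zero_add, WithBot.coe_lt_coe]

@[simp] lemma point_mem_upper : point s ∈ upper t ↔ t < s := by
  change ((0 : ℝ) : TNum) + (t : TNum) < (s : TNum) ↔ t < s
  rw [← WithBot.coe_add, zero_add, WithBot.coe_lt_coe]

@[simp] lemma leftEnd_notMem_one : leftEnd ∉ chartDomain (n := 1) 1 := fun h => h rfl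

@[simp] lemma rightEnd_notMem_zero : rightEnd ∉ chartDomain (n := 1) 0 := fun h => h rfl

lemma point_mem (i : Fin 2) : point t ∈ chartDomain (n := 1) i := by
  change ((![0, t] i : ℝ) : TNum) ≠ ⊥
  exact WithBot.coe_ne_bot

lemma diff_point : diff 0 1 (point t) = t := by
  simp [point, diff_ofReal]

end membership

lemma continuous_add_coe (t : ℝ) : Continuous fun x : TNum => x + (t : TNum) := by
  let e : TNum ≃o TNum := (OrderIso.addRight t).withBotCongr
  have he : (fun x : TNum => x + (t : TNum)) = e := by
    funext x
    rcases x with _ | x <;> rfl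
  exact he ▸ e.continuous

lemma continuous_coord (i : Fin 2) : Continuous fun x : Punctured 1 => x.1 i :=
  (continuous_apply i).comp continuous_subtype_val

lemma isOpen_lower (t : ℝ) : IsOpen (lower t) := by
  rw [← isQuotientMap_mk.isOpen_preimage]
  exact isOpen_lt (continuous_coord 1) ((continuous_add_coe t).comp (continuous_coord 0))

lemma isOpen_upper (t : ℝ) : IsOpen (upper t) := by
  rw [← isQuotientMap_mk.isOpen_preimage]
  exact isOpen_lt ((continuous_add_coe t).comp (continuous_coord 0)) (continuous_coord 1)

lemma continuous_point : Continuous point := by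
  refine isQuotientMap_mk.continuous.comp (Continuous.subtype_mk (continuous_pi fun i => ?_) _)
  fin_cases i
  · exact (continuous_const : Continuous fun _ : ℝ => ((0 : ℝ) : TNum))
  · exact isOpenEmbedding_coe.continuous

lemma exists_lower_subset {W : Set (TP 1)} (hW : W ∈ 𝓝 leftEnd) : ∃ a, lower a ⊆ W := by
  let f : TNum → TP 1 := fun s => mk ⟨![0, s], 0, by simp⟩
  have hf : Continuous f := by
    refine isQuotientMap_mk.continuous.comp (Continuous.subtype_mk (continuous_pi fun i => ?_) _)
    fin_cases i
    · exact continuous_const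
    · exact continuous_id
  obtain ⟨a, ha, h⟩ := (nhds_bot_basis (α := TNum)).mem_iff.1 (hf.continuousAt (x := ⊥) hW)
  obtain ⟨a, rfl⟩ := WithBot.ne_bot_iff_exists.1 ha.ne'
  refine ⟨a, fun p hp => ?_⟩
  rcases eq_end_or_eq_point p with rfl | rfl | ⟨t, rfl⟩
  · exact mem_of_mem_nhds hW
  · simp at hp
  · have h1 : f (t : TNum) ∈ W :=
      h (show (t : TNum) < a from WithBot.coe_lt_coe.2 (by simpa using hp))
    have h2 : f (t : TNum) = point t := by
      refine congrArg mk (Subtype.ext (funext fun i => ?_))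
      fin_cases i <;> rfl
    exact h2 ▸ h1

lemma exists_upper_subset {W : Set (TP 1)} (hW : W ∈ 𝓝 rightEnd) : ∃ a, upper a ⊆ W := by
  -- For real `s`, `[s : 0]` is `point (-s)`, whence the change of sign.
  let f : TNum → TP 1 := fun s => mk ⟨![s, 0], 1, by simp⟩
  have hf : Continuous f := by
    refine isQuotientMap_mk.continuous.comp (Continuous.subtype_mk (continuous_pi fun i => ?_) _)
    fin_cases i
    · exact continuous_id
    · exact continuous_const
  obtain ⟨a, ha, h⟩ := (nhds_bot_basis (α := TNum)).mem_iff.1 (hf.continuousAt (x := ⊥) hW)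
  obtain ⟨a, rfl⟩ := WithBot.ne_bot_iff_exists.1 ha.ne'
  refine ⟨-a, fun p hp => ?_⟩
  rcases eq_end_or_eq_point p with rfl | rfl | ⟨t, rfl⟩
  · simp at hp
  · exact mem_of_mem_nhds hW
  · have hp' : -a < t := by simpa using hp
    have h1 : f ((-t : ℝ) : TNum) ∈ W :=
      h (show ((-t : ℝ) : TNum) < a from WithBot.coe_lt_coe.2 (by linarith))
    have h2 : f ((-t : ℝ) : TNum) = point t := by
      have h3 := ofReal_eq_point ![-t, 0]
      simp only [Matrix.cons_val_zero, Matrix.cons_val_one, zero_sub, neg_neg] at h3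
      rw [← h3]
      refine congrArg mk (Subtype.ext (funext fun i => ?_))
      fin_cases i <;> rfl
    exact h2 ▸ h1

lemma exists_strip_subset {W : Set (TP 1)} {t : ℝ} (hW : W ∈ 𝓝 (point t)) :
    ∃ a b, a < t ∧ t < b ∧ upper a ∩ lower b ⊆ W := by
  obtain ⟨a, b, hab, h⟩ := mem_nhds_iff_exists_Ioo_subset.1 (continuous_point.continuousAt hW)
  refine ⟨a, b, hab.1, hab.2, fun p hp => ?_⟩
  rcases eq_end_or_eq_point p with rfl | rfl | ⟨s, rfl⟩
  · simp at hp
  · simp at hp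
  · exact h (by simpa using hp)

instance : CompactSpace (TP 1) := by
  refine ⟨isCompact_of_finite_subcover fun {ι} U hU hcover => ?_⟩
  obtain ⟨i, hi⟩ := mem_iUnion.1 (hcover (mem_univ leftEnd))
  obtain ⟨j, hj⟩ := mem_iUnion.1 (hcover (mem_univ rightEnd))
  obtain ⟨a, ha⟩ := exists_lower_subset ((hU i).mem_nhds hi)
  obtain ⟨b, hb⟩ := exists_upper_subset ((hU j).mem_nhds hj)
  obtain ⟨s, hs⟩ := ((isCompact_Icc (a := a) (b := b)).image continuous_point).elim_finite_subcover
    U hU ((subset_univ _).trans hcover)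
  classical
  refine ⟨insert i (insert j s), fun p _ => ?_⟩
  simp only [Finset.mem_insert, iUnion_iUnion_eq_or_left]
  rcases eq_end_or_eq_point p with rfl | rfl | ⟨t, rfl⟩
  · exact Or.inl hi
  · exact Or.inr (Or.inl hj)
  · rcases lt_or_ge t a with h | h
    · exact Or.inl (ha (by simpa using h))
    rcases lt_or_ge b t with h' | h'
    · exact Or.inr (Or.inl (hb (by simpa using h')))
    exact Or.inr (Or.inr (hs ⟨t, ⟨h, h'⟩, rfl⟩))

/-- At a point of the open part `ℝ` of the tropical projective line, the regular invertible
functions are the integer affine functions of the coordinate `x₁ - x₀`. -/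
lemma exists_affine {g : TP 1 → ℝ} {t : ℝ} (hg : RegAt g (point t)) :
    ∃ (m : ℤ) (c : ℝ), ∀ᶠ q in 𝓝 (point t), g q = m * diff 0 1 q + c := by
  obtain ⟨-, m, c, -, h⟩ := hg
  refine ⟨m 1, c, ?_⟩
  filter_upwards [h, (isOpen_upper (t - 1)).mem_nhds (by simp),
    (isOpen_lower (t + 1)).mem_nhds (by simp)] with q hq h1 h2
  rcases eq_end_or_eq_point q with rfl | rfl | ⟨s, rfl⟩
  · simp at h1
  · simp at h2
  · rw [hq _ rfl, diff_point]
    simp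

lemma regAt_affine (m : ℤ) (c : ℝ) {p : TP 1} (h0 : p ∈ chartDomain (n := 1) 0)
    (h1 : p ∈ chartDomain (n := 1) 1) : RegAt (fun q => m * diff 0 1 q + c) p :=
  add (regAt_zsmul (regularOn_diff 0 1 p ⟨h0, h1⟩) m) (const c p)

end TP

/-! ### Frames on the tropical projective line -/

section frames

open TP TropicalVectorBundle

variable {n : ℕ} {E : TropicalVectorBundle (TP 1) n} {u v : E.Total → Fin n → ℝ}

/-- Two frames at a point of the open part `ℝ` differ by a permutation and integer affine
functions of the coordinate, which are defined on all of `ℝ`. -/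
lemma exists_affine_of_frameAt {t : ℝ} (hu : E.FrameAt u (point t)) (hv : E.FrameAt v (point t)) :
    ∃ (σ : Equiv.Perm (Fin n)) (m : Fin n → ℤ) (c : Fin n → ℝ), ∀ᶠ y in 𝓝 (point t),
      ∀ p, E.proj p = y → u p = fun k => m k * diff 0 1 y + c k + v p (σ k) := by
  obtain ⟨σ, g, hg, h⟩ := hu.monomialAt hv
  choose m c hmc using fun k => exists_affine (hg k)
  refine ⟨σ, m, c, ?_⟩
  filter_upwards [h, eventually_all.2 hmc] with y hy hgy p hp
  exact funext fun k => by rw [hy p hp k, hgy k]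

lemma TropicalVectorBundle.FrameAt.affine {x : TP 1} (hv : E.FrameAt v x)
    (h0 : x ∈ chartDomain (n := 1) 0) (h1 : x ∈ chartDomain (n := 1) 1)
    (σ : Equiv.Perm (Fin n)) (m : Fin n → ℤ) (c : Fin n → ℝ) :
    E.FrameAt (fun p k => m k * diff 0 1 (E.proj p) + c k + v p (σ k)) x :=
  hv.of_monomialAt ⟨σ, fun k q => m k * diff 0 1 q + c k, fun k => regAt_affine (m k) (c k) h0 h1,
    Eventually.of_forall fun y p hp k => by subst hp; rfl⟩

open Classical in
/-- Frames that agree near the fibre over `point t` can be glued there. -/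
lemma frameAt_ite {t : ℝ}
    (huv : ∀ᶠ y in 𝓝 (point t), ∀ p, E.proj p = y → u p = v p) {x : TP 1}
    (hu : x ∉ upper t → E.FrameAt u x) (hv : x ∈ upper t → E.FrameAt v x) :
    E.FrameAt (fun p => if E.proj p ∈ upper t then v p else u p) x := by
  by_cases hx : x ∈ upper t
  · refine (hv hx).congr ?_
    filter_upwards [(isOpen_upper t).mem_nhds hx] with y hy p hp
    rw [if_pos (hp ▸ hy)]
  refine (hu hx).congr ?_
  by_cases hx' : x ∈ lower t
  · filter_upwards [(isOpen_lower t).mem_nhds hx'] with y hy p hp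
    refine if_neg fun h => ?_
    rw [hp] at h
    rcases eq_end_or_eq_point y with rfl | rfl | ⟨s, rfl⟩
    · simp at h
    · simp at hy
    · simp only [point_mem_lower, point_mem_upper] at hy h
      exact lt_asymm hy h
  · have hxt : x = point t := by
      rcases eq_end_or_eq_point x with rfl | rfl | ⟨s, rfl⟩
      · simp at hx'
      · simp at hx
      · simp only [point_mem_lower, point_mem_upper, not_lt] at hx hx'
        rw [le_antisymm hx hx']
    rw [hxt]
    filter_upwards [huv] with y hy p hp
    split_ifs
    · exact (hy p hp).symm
    · rfl

variable (E) in
/-- Every bundle has a frame over `[-∞, t]`, for every real `t`. -/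
lemma exists_frame_compl_upper (t : ℝ) :
    ∃ u : E.Total → Fin n → ℝ, ∀ x ∉ upper t, E.FrameAt u x := by
  let S : Set ℝ := {t | ∃ u : E.Total → Fin n → ℝ, ∀ x ∉ upper t, E.FrameAt u x}
  have hmono : ∀ s t, s ≤ t → t ∈ S → s ∈ S := by
    rintro s t hst ⟨u, hu⟩
    refine ⟨u, fun x hx => hu x fun h => hx ?_⟩
    rcases eq_end_or_eq_point x with rfl | rfl | ⟨r, rfl⟩
    · simp at h
    · simp
    · simp only [point_mem_upper] at h ⊢
      exact hst.trans_lt h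
  -- A frame over `[-∞, s]` extends across a strip over which the bundle is trivial.
  have hglue : ∀ a b (i : Fin E.s), upper a ∩ lower b ⊆ (E.triv i).baseSet →
      ∀ s t, a < s → s ≤ t → t < b → s ∈ S → t ∈ S := by
    rintro a b i hab s t has hst htb ⟨u, hu⟩
    have hi : ∀ r, a < r → r < b → E.FrameAt (E.coord i) (point r) := fun r h1 h2 =>
      frameAt_coord i (hab ⟨by simpa using h1, by simpa using h2⟩)
    obtain ⟨σ, m, c, h⟩ :=
      exists_affine_of_frameAt (hu (point s) (by simp)) (hi s has (hst.trans_lt htb))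
    classical
    refine ⟨fun p => if E.proj p ∈ upper s then
      fun k => m k * diff 0 1 (E.proj p) + c k + E.coord i p (σ k) else u p, fun x hx => ?_⟩
    refine frameAt_ite (h.mono fun y hy p hp => ?_) (hu x) fun hxs => ?_
    · rw [hy p hp, hp]
    · rcases eq_end_or_eq_point x with rfl | rfl | ⟨r, rfl⟩
      · simp at hxs
      · simp at hx
      · simp only [point_mem_upper, not_lt] at hxs hx
        exact (hi r (has.trans hxs) (hx.trans_lt htb)).affine (point_mem _ _) (point_mem _ _) σ m c
  have hloc : ∀ s, ∀ᶠ t in 𝓝 s, s ∈ S ↔ t ∈ S := by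
    intro s
    obtain ⟨i, hi⟩ := E.cover (point s)
    obtain ⟨a, b, has, hsb, hab⟩ := exists_strip_subset ((E.triv i).open_baseSet.mem_nhds hi)
    filter_upwards [Ioo_mem_nhds has hsb] with t ht
    rcases le_total s t with hst | hst
    · exact ⟨hglue a b i hab s t has hst ht.2, hmono s t hst⟩
    · exact ⟨hmono t s hst, hglue a b i hab t s ht.1 hst hsb⟩
  have hclopen : IsClopen S := by
    constructor
    · rw [← isOpen_compl_iff, isOpen_iff_mem_nhds]
      intro s hs
      filter_upwards [hloc s] with t ht
      exact fun h => hs (ht.2 h)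
    · rw [isOpen_iff_mem_nhds]
      intro s hs
      filter_upwards [hloc s] with t ht
      exact ht.1 hs
  have hne : S.Nonempty := by
    obtain ⟨i, hi⟩ := E.cover leftEnd
    obtain ⟨a, ha⟩ := exists_lower_subset ((E.triv i).open_baseSet.mem_nhds hi)
    refine ⟨a - 1, E.coord i, fun x hx => frameAt_coord i (ha ?_)⟩
    rcases eq_end_or_eq_point x with rfl | rfl | ⟨r, rfl⟩
    · simp
    · simp at hx
    · simp only [point_mem_lower, point_mem_upper, not_lt] at hx ⊢
      linarith
  have ht : t ∈ S := hclopen.eq_univ hne ▸ mem_univ t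
  exact ht

variable (E) in
/-- There are frames over `U₀` and `U₁` that differ over `U₀ ∩ U₁` only by integer multiples of the
coordinate. -/
lemma exists_frames : ∃ (d : Fin n → ℤ) (u : Fin 2 → E.Total → Fin n → ℝ),
    (∀ i, ∀ x ∈ chartDomain (n := 1) i, E.FrameAt (u i) x) ∧
    ∀ p k, u 1 p k = d k * diff 0 1 (E.proj p) + u 0 p k := by
  obtain ⟨i, hi⟩ := E.cover rightEnd
  obtain ⟨a, ha⟩ := exists_upper_subset ((E.triv i).open_baseSet.mem_nhds hi)
  -- The comparison takes place at a point of the open set `upper a`.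
  let b := a + 1
  obtain ⟨u, hu⟩ := exists_frame_compl_upper E b
  have hv : ∀ x, x ∉ lower b → E.FrameAt (E.coord i) x := fun x hx => by
    refine frameAt_coord i (ha ?_)
    rcases eq_end_or_eq_point x with rfl | rfl | ⟨r, rfl⟩
    · simp at hx
    · simp
    · simp only [point_mem_lower, point_mem_upper, not_lt, b] at hx ⊢
      linarith
  obtain ⟨σ, m, c, h⟩ := exists_affine_of_frameAt (hu (point b) (by simp)) (hv (point b) (by simp))
  classical
  -- The permutation and the constants `c` are absorbed into the frame near `rightEnd`; the linear
  -- parts `m` cannot be, since they do not extend to `rightEnd`.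
  let u₀ : E.Total → Fin n → ℝ := fun p => if E.proj p ∈ upper b then
    fun k => m k * diff 0 1 (E.proj p) + c k + E.coord i p (σ k) else u p
  let u₁ : E.Total → Fin n → ℝ := fun p => if E.proj p ∈ upper b then
    fun k => c k + E.coord i p (σ k) else
    fun k => (-m k : ℤ) * diff 0 1 (E.proj p) + 0 + u p k
  refine ⟨fun k => -m k, ![u₀, u₁], fun j x hx => ?_, fun p k => ?_⟩
  · have hx' : j = 0 ∨ j = 1 := by fin_cases j <;> simp
    rcases hx' with rfl | rfl
    · refine frameAt_ite (h.mono fun y hy p hp => ?_) (hu x) fun hxb => ?_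
      · rw [hy p hp, hp]
      · rcases eq_end_or_eq_point x with rfl | rfl | ⟨r, rfl⟩
        · simp at hxb
        · simp at hx
        · simp only [point_mem_upper] at hxb
          exact (hv (point r) (by simpa using hxb.le)).affine (point_mem _ _) (point_mem _ _) σ m c
    · refine frameAt_ite (h.mono fun y hy p hp => ?_) (fun hxb => ?_) fun hxb => ?_
      · rw [hy p hp, hp]
        funext k
        push_cast
        ring
      · rcases eq_end_or_eq_point x with rfl | rfl | ⟨r, rfl⟩
        · simp at hx
        · simp at hxb
        · exact (hu _ hxb).affine (point_mem _ _) (point_mem _ _) 1 (fun k => -m k) fun _ => 0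
      · refine (hv x ?_).of_monomialAt ⟨σ, fun k _ => c k, fun k => const _ _,
          Eventually.of_forall fun _ _ _ _ => rfl⟩
        rcases eq_end_or_eq_point x with rfl | rfl | ⟨r, rfl⟩
        · simp at hxb
        · simp
        · simpa using (point_mem_upper r b).1 hxb |>.le
  · simp only [Matrix.cons_val_zero, Matrix.cons_val_one, u₀, u₁]
    split_ifs <;> (push_cast; ring)

end frames

end TropVB

theorem mainTheorem6 (n : ℕ) (E : TropVB.TropicalVectorBundle (TropVB.TP 1) n) :
    ∃ d : Fin n → ℤ, TropVB.Isomorphic E (TropVB.TP.sumO 1 d) := by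
  obtain ⟨d, u, hu, hd⟩ := TropVB.exists_frames E
  refine ⟨d, TropVB.isomorphic_toBundle _ u hu fun i j p hi hj => funext fun k => ?_⟩
  have hact : TropVB.act (TropVB.tdiag fun k =>
      ((d k * TropVB.TP.diff i j (E.proj p) : ℝ) : TropVB.TNum)) (u i p) k =
      d k * TropVB.TP.diff i j (E.proj p) + u i p k :=
    TropVB.act_of_normalForm (σ := id) (g := fun k => d k * TropVB.TP.diff i j (E.proj p))
      (fun k l => by simp [TropVB.tdiag, eq_comm]) (u i p) k
  refine Eq.trans ?_ hact.symm
  have hneg := TropVB.TP.diff_add_diff i j i ⟨⟨hi, hj⟩, hi⟩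
  rw [TropVB.TP.diff_self] at hneg
  fin_cases i <;> fin_cases j
  · simp [TropVB.TP.diff_self]
  · exact hd p k
  · simp only [Fin.mk_one, Fin.zero_eta] at hneg ⊢
    rw [hd p k]
    linear_combination (-(d k : ℝ)) * hneg
  · simp [TropVB.TP.diff_self]
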